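/- All graphs are finite and simple. For a graph $G$ and a function $f:V(G)\to\mathbb N$, the on-line $f$-list coloring game is played by Alice and Bob on $G$, all of whose vertices are initially uncolored. In the $i$-th round Alice marks a nonempty set $V_i$ of uncolored vertices (thereby assigning the color $i$ as a permissible color to each vertex of $V_i$), and Bob then chooses an independent set $X_i\subseteq V_i$ of $G$ and colors all vertices of $X_i$ with the color $i$. Alice wins if at some time (before the first round or at the end of a round) there is an uncolored vertex $v$ that has been marked $f(v)$ times; otherwise Bob wins. The graph $G$ is on-line $k$-choosable if Bob has a winning strategy in the game with $f(v)=k$ for all $v\in V(G)$. The on-line choice number $\chi_p(G)$ is the least $k$ such that $G$ is on-line $k$-choosable, and $G$ is on-line chromatic-choosable if $\chi_p(G)=\chi(G)$, where $\chi(G)$ is the chromatic number. **Corollary.** If $G$ is a graph with independence number $m\ge 2$ and $$|V(G)|\le \frac{m^2-m+2}{m^2-3m+4}\,\chi(G),$$ then $\chi_p(G)=\chi(G)$. Consequently, every graph $G$ with $|V(G)|\le 2\chi(G)$ and independence number at most $3$ is on-line chromatic-choosable. -/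

import Mathlib

namespace OnlineColoring

variable {V : Type*} [DecidableEq V]

/-- A history of the on-line list coloring game is the list of the sets marked by Alice so far,
the most recent one first. A strategy of Bob names, for every history (which ends with the set
that Alice has just marked), the set of vertices that Bob colors in that round. -/
abbrev Strategy (V : Type*) := List (Finset V) → Finset V

/-- The set of vertices colored by Bob in the course of the history, if he follows `σ`. -/
def colored (σ : Strategy V) : List (Finset V) → Finset V
  | [] => ∅
  | U :: h => colored σ h ∪ σ (U :: h)

/-- Alice's moves in the history are legal against `σ`: in every round she marks a nonempty set of
vertices that are still uncolored. -/
def LegalHistory (σ : Strategy V) : List (Finset V) → Prop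
  | [] => True
  | U :: h => LegalHistory σ h ∧ U.Nonempty ∧ Disjoint U (colored σ h)

/-- The number of rounds in which `v` was marked, i.e. the number of permissible colors that `v`
has been assigned. -/
def timesMarked (v : V) (h : List (Finset V)) : ℕ :=
  h.countP (fun U => v ∈ U)

/-- Bob's moves are legal: in every round he colors an independent subset of the marked set. -/
def Strategy.IsLegal (G : SimpleGraph V) (σ : Strategy V) : Prop :=
  ∀ (U : Finset V) (h : List (Finset V)), LegalHistory σ (U :: h) →
    σ (U :: h) ⊆ U ∧ G.IsIndepSet (σ (U :: h) : Set V)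

/-- `σ` is a winning strategy of Bob in the on-line `f`-list coloring game: at no time (before the
first round or at the end of a round) is there an uncolored vertex `v` that has already been
assigned `f v` permissible colors. -/
def Strategy.IsWinning (G : SimpleGraph V) (f : V → ℕ) (σ : Strategy V) : Prop :=
  σ.IsLegal G ∧ ∀ h : List (Finset V), LegalHistory σ h →
    ∀ v : V, v ∉ colored σ h → timesMarked v h < f v

/-- `G` is on-line `f`-choosable. -/
def OnlineChoosable (G : SimpleGraph V) (f : V → ℕ) : Prop :=
  ∃ σ : Strategy V, σ.IsWinning G f

/-- The on-line choice number `χ_p(G)`: the least `k` such that `G` is on-line `k`-choosable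
(and `⊤` if there is no such `k`, like Mathlib's `SimpleGraph.chromaticNumber`). -/
noncomputable def onlineChoiceNumber (G : SimpleGraph V) : ℕ∞ :=
  ⨅ k ∈ {k : ℕ | OnlineChoosable G (fun _ => k)}, (k : ℕ∞)

/-- `G` is on-line chromatic-choosable: `χ_p(G) = χ(G)`. -/
def OnlineChromaticChoosable (G : SimpleGraph V) : Prop :=
  onlineChoiceNumber G = G.chromaticNumber

end OnlineColoring

open Finset OnlineColoring

namespace OnlineColoring

/-! ### Strategies from invariants -/

variable {V : Type*} [DecidableEq V]

/-! Bob starts from a coloring with k = χ(G) colors. Classes with at least two vertices are parts,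
and singletons form a queue. Each vertex has k tokens and pays one when marked. Bob keeps the
invariant `Good`: any j vertices of a part jointly own the sum of the layers 0, …, j - 1, where a
part of size p weighs 1 in layer 0 and max(1, p - i) in layer i ≥ 1, and a queued vertex counts in
the layers 1 up to its level. A queued vertex owns its rank plus the weight of all parts at its
level.

Bob's reply (`Good.exists_move`) lowers enough layers to pay for the marks. He colors a fully marked
part; failing that, the marked vertices of a part with a largest tight marked set, queueing the rest
of the part. If nothing is tight, he compares levels in the queue with marked counts in the parts
and serves whichever is larger.

At the start, a part of size p exceeds weight 1 per layer by at most C(p-1, 2) in total, while each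
singleton saves one token by missing layer 0. So Bob wins if the sum of C(p-1, 2) is at most the
number of singletons (`onlineChoosable_of_coloring`). As C(p-1, 2) - [p = 1] is convex, its chord
over 1 ≤ p ≤ m turns this into the bound on |V(G)|/χ(G). -/

/-- A property of positions (uncolored vertices and remaining tokens) that Bob can maintain and that
forces tokens to be positive yields a winning strategy. -/
theorem onlineChoosable_of_invariant [Fintype V] (G : SimpleGraph V) (f : V → ℕ)
    (I : Finset V → (V → ℤ) → Prop)
    (start : I univ (fun v => f v))
    (pos : ∀ C g, I C g → ∀ v ∈ C, 0 < g v)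
    (step : ∀ C g, I C g → ∀ U ⊆ C, U.Nonempty → ∃ X ⊆ U, G.IsIndepSet (X : Set V) ∧
      I (C \ X) (fun v => g v - if v ∈ U then 1 else 0)) :
    OnlineChoosable G f := by
  classical
  have step' : ∀ C g U, ∃ X : Finset V, I C g → U ⊆ C → U.Nonempty →
      X ⊆ U ∧ G.IsIndepSet (X : Set V) ∧ I (C \ X) (fun v => g v - if v ∈ U then 1 else 0) := by
    intro C g U
    by_cases h : I C g ∧ U ⊆ C ∧ U.Nonempty
    · obtain ⟨X, h1, h2, h3⟩ := step C g h.1 U h.2.1 h.2.2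
      exact ⟨X, fun _ _ _ => ⟨h1, h2, h3⟩⟩
    · exact ⟨∅, fun a b c => (h ⟨a, b, c⟩).elim⟩
  choose ch hch using step'
  let tok : List (Finset V) → V → ℤ := fun h v => (f v : ℤ) - timesMarked v h
  -- Computed from the replies `ch` alone, so `σ` can use the uncolored set without circular
  -- reference to `colored σ`.
  let c : List (Finset V) → Finset V := fun h =>
    List.rec (motive := fun _ => Finset V) ∅ (fun U h r => r ∪ ch (univ \ r) (tok h) U) h
  let σ : Strategy V := fun h => match h with
    | [] => ∅
    | U :: h => ch (univ \ c h) (tok h) U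
  have hc : ∀ h, colored σ h = c h := by
    intro h
    induction h with
    | nil => rfl
    | cons U h ih =>
      change colored σ h ∪ _ = c h ∪ _
      rw [ih]
  have hU : ∀ (U h : _), Disjoint U (colored σ h) → U ⊆ univ \ c h := by
    intro U h hd v hv
    simp only [mem_sdiff, mem_univ, true_and]
    rw [← hc]
    exact disjoint_left.1 hd hv
  have inv : ∀ h, LegalHistory σ h → I (univ \ c h) (tok h) := by
    intro h
    induction h with
    | nil =>
      intro _
      simpa [c, tok, timesMarked] using start
    | cons U h ih =>
      rintro ⟨hl, hne, hd⟩
      obtain ⟨-, -, h3⟩ := hch _ _ U (ih hl) (hU U h hd) hne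
      have e1 : univ \ c (U :: h) = (univ \ c h) \ ch (univ \ c h) (tok h) U := by
        change univ \ (c h ∪ _) = _
        rw [sdiff_sdiff_left]
        rfl
      have e2 : tok (U :: h) = fun v => tok h v - if v ∈ U then 1 else 0 := by
        funext v
        simp only [tok, timesMarked, List.countP_cons, decide_eq_true_eq]
        push_cast
        ring
      rw [e1, e2]
      exact h3
  refine ⟨σ, ?_, ?_⟩
  · rintro U h ⟨hl, hne, hd⟩
    obtain ⟨h1, h2, -⟩ := hch _ _ U (inv h hl) (hU U h hd) hne
    exact ⟨h1, h2⟩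
  · intro h hl v hv
    have := pos _ _ (inv h hl) v (by simpa [← hc] using hv)
    simp only [tok] at this
    omega

/-! ### The bound χ ≤ χ_p -/

/-- Rounds serve as colors, because each reply is independent. -/
theorem exists_coloring_of_legalHistory {G : SimpleGraph V} {σ : Strategy V} (hσ : σ.IsLegal G)
    (h : List (Finset V)) (hl : LegalHistory σ h) :
    ∃ c : V → ℕ, (∀ v ∈ colored σ h, c v < h.length) ∧
      ∀ v ∈ colored σ h, ∀ w ∈ colored σ h, G.Adj v w → c v ≠ c w := by
  induction h with
  | nil => exact ⟨fun _ => 0, by simp [colored], by simp [colored]⟩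
  | cons U h ih =>
    obtain ⟨c, h1, h2⟩ := ih hl.1
    have hi := (hσ U h hl).2
    refine ⟨fun v => if v ∈ colored σ h then c v else h.length, ?_, ?_⟩
    · intro v _
      dsimp only
      split_ifs with hv
      · have := h1 v hv
        simp only [List.length_cons]
        omega
      · simp
    · intro v hv w hw hvw
      simp only [colored, mem_union] at hv hw
      dsimp only
      split_ifs with a b b
      · exact h2 v a w b hvw
      · exact (h1 v a).ne
      · exact (h1 w b).ne'
      · exact (hi (hv.resolve_left a) (hw.resolve_left b) hvw.ne hvw).elim

/-- Alice marks every uncolored vertex in each round. She can run out of vertices early, hence only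
an upper bound on the length. -/
theorem exists_legalHistory_marking_all [Fintype V] (σ : Strategy V) (n : ℕ) :
    ∃ h, LegalHistory σ h ∧ h.length ≤ n ∧ ∀ v ∉ colored σ h, timesMarked v h = n := by
  induction n with
  | zero => exact ⟨[], trivial, le_rfl, fun _ _ => rfl⟩
  | succ n ih =>
    obtain ⟨h, h1, h2, h3⟩ := ih
    by_cases hc : (univ \ colored σ h).Nonempty
    · refine ⟨(univ \ colored σ h) :: h, ⟨h1, hc, sdiff_disjoint⟩, by simpa using h2, ?_⟩
      intro v hv
      simp only [colored, mem_union, not_or] at hv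
      have := h3 v hv.1
      simp only [timesMarked, List.countP_cons] at this ⊢
      simp [this, hv.1]
    · refine ⟨h, h1, h2.trans n.le_succ, fun v hv => (hc ⟨v, by simpa using hv⟩).elim⟩

theorem OnlineChoosable.colorable [Fintype V] {G : SimpleGraph V} {k : ℕ}
    (hG : OnlineChoosable G (fun _ => k)) : G.Colorable k := by
  obtain ⟨σ, hσ, hw⟩ := hG
  obtain ⟨h, h1, h2, h3⟩ := exists_legalHistory_marking_all σ k
  have hall : ∀ v, v ∈ colored σ h := by
    intro v
    by_contra hv
    have := hw h h1 v hv
    rw [h3 v hv] at this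
    exact this.false
  obtain ⟨c, c1, c2⟩ := exists_coloring_of_legalHistory hσ h h1
  exact ⟨SimpleGraph.Coloring.mk (fun v => ⟨c v, (c1 v (hall v)).trans_le h2⟩) (by
    intro v w hvw he
    exact c2 v (hall v) w (hall w) hvw (congrArg Fin.val he))⟩

theorem chromaticNumber_le_onlineChoiceNumber [Fintype V] (G : SimpleGraph V) :
    G.chromaticNumber ≤ onlineChoiceNumber G :=
  le_iInf₂ fun _ hk => (OnlineChoosable.colorable hk).chromaticNumber_le

/-! ### Demands and the invariant -/

/-- The contribution of a part with `p` vertices to the `i`-th layer of demands. -/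
def partWeight (i p : ℕ) : ℕ := if i = 0 then 1 else max 1 (p - i)

/-- The contribution of all parts in `𝒜` to the `i`-th layer of demands. -/
def partDemand (𝒜 : Finset (Finset V)) (i : ℕ) : ℕ := ∑ P ∈ 𝒜, partWeight i #P

/-- The `i`-th layer of demands: a queued vertex `w` contributes to the layers `1, …, lv w`. -/
def layer (𝒜 : Finset (Finset V)) (S : Finset V) (lv : V → ℕ) (i : ℕ) : ℕ :=
  partDemand 𝒜 i + #{w ∈ S | 1 ≤ i ∧ i ≤ lv w}

/-- The number of tokens demanded from `j` vertices of one part. -/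
def demand (𝒜 : Finset (Finset V)) (S : Finset V) (lv : V → ℕ) (j : ℕ) : ℕ :=
  ∑ i ∈ range j, layer 𝒜 S lv i

/-- The position of `v` in the queue `S`, which is sorted by decreasing level, then by time. -/
def queueRank (S : Finset V) (lv tm : V → ℕ) (v : V) : ℕ :=
  #{w ∈ S | lv v < lv w ∨ (lv v = lv w ∧ tm w ≤ tm v)}

/-- The tokens left after Alice has marked `U`. -/
def spend (U : Finset V) (g : V → ℤ) (v : V) : ℤ := g v - if v ∈ U then 1 else 0

/-- Bob's invariant: the uncolored vertices are split into independent parts and a queue `S`,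
with enough tokens left in every subset of a part and at every place of the queue. -/
structure Good (G : SimpleGraph V) (g : V → ℤ) (𝒜 : Finset (Finset V)) (S : Finset V)
    (lv tm : V → ℕ) : Prop where
  disj : ∀ P ∈ 𝒜, ∀ Q ∈ 𝒜, P ≠ Q → Disjoint P Q
  disjQueue : ∀ P ∈ 𝒜, Disjoint P S
  indep : ∀ P ∈ 𝒜, G.IsIndepSet (P : Set V)
  two_le : ∀ P ∈ 𝒜, 2 ≤ #P
  one_le : ∀ v ∈ S, 1 ≤ lv v
  parts : ∀ P ∈ 𝒜, ∀ X ⊆ P, (demand 𝒜 S lv #X : ℤ) ≤ ∑ v ∈ X, g v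
  queue : ∀ v ∈ S, ((partDemand 𝒜 (lv v) + queueRank S lv tm v : ℕ) : ℤ) ≤ g v

theorem one_le_partWeight (i p : ℕ) : 1 ≤ partWeight i p := by
  unfold partWeight; split_ifs <;> omega

theorem sum_spend (U X : Finset V) (g : V → ℤ) :
    ∑ v ∈ X, spend U g v = ∑ v ∈ X, g v - #(X ∩ U) := by
  simp [spend, sum_sub_distrib]

theorem sum_range_add_le {a b : ℕ → ℕ} (n : ℕ) (h : ∀ i < n, b i + 1 ≤ a i) :
    ∑ i ∈ range n, b i + n ≤ ∑ i ∈ range n, a i := by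
  have := sum_le_sum fun i hi => h i (mem_range.1 hi)
  simpa [sum_add_distrib] using this

theorem sum_range_add_pred_le {a b : ℕ → ℕ} {j : ℕ} (h : ∀ i, i ≠ j → b i + 1 ≤ a i)
    (hj : b j ≤ a j) (n : ℕ) : ∑ i ∈ range n, b i + (n - 1) ≤ ∑ i ∈ range n, a i := by
  -- The induction needs this sharper form, where the unit is lost only after `j` has been passed.
  have : ∑ i ∈ range n, b i + n ≤ ∑ i ∈ range n, a i + if j < n then 1 else 0 := by
    induction n with
    | zero => simp
    | succ n ih =>
      rw [sum_range_succ, sum_range_succ]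
      rcases eq_or_ne n j with rfl | hn
      · simp only [lt_self_iff_false, if_false] at ih
        simp only [Nat.lt_succ_self, if_true]
        omega
      · have := h n hn
        split_ifs at ih ⊢ <;> omega
  split_ifs at this <;> omega

theorem sum_range_add_min_le {a b : ℕ → ℕ} {t : ℕ} (h : ∀ i, b i ≤ a i)
    (ht : ∀ i, 1 ≤ i → i ≤ t → b i + 1 ≤ a i) (n : ℕ) :
    ∑ i ∈ range n, b i + min (n - 1) t ≤ ∑ i ∈ range n, a i := by
  induction n with
  | zero => simp
  | succ n ih =>
    rw [sum_range_succ, sum_range_succ]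
    have := h n
    by_cases hn : 1 ≤ n ∧ n ≤ t
    · have := ht n hn.1 hn.2
      omega
    · omega

/-- A set not inside `U` spends at most `#X - 1` and at most `t` tokens, which the drop from `a` to
`b` covers. A marked set may spend one more, and its spare token pays for that. -/
theorem le_sum_spend_of_not_tight {U X : Finset V} {g : V → ℤ} {a b t : ℕ} (hX : #(X ∩ U) ≤ t)
    (ha : (a : ℤ) ≤ ∑ v ∈ X, g v) (hnt : X ⊆ U → X.Nonempty → (a : ℤ) + 1 ≤ ∑ v ∈ X, g v)
    (hb : b + min (#X - 1) t ≤ a) : (b : ℤ) ≤ ∑ v ∈ X, spend U g v := by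
  rw [sum_spend]
  by_cases hXU : X ⊆ U
  · rcases X.eq_empty_or_nonempty with rfl | hne
    · simp only [sum_empty] at ha
      simp
      omega
    · have := hnt hXU hne
      have hp := hne.card_pos
      rw [inter_eq_left.2 hXU] at hX ⊢
      omega
  · have : #(X ∩ U) < #X := card_lt_card
      ⟨inter_subset_left, fun h => hXU (h.trans inter_subset_right)⟩
    omega

/-! ### Removing a part and enqueueing its remainder -/

section Erase

variable {𝒜 : Finset (Finset V)} {S P U : Finset V} {lv tm : V → ℕ}

theorem partDemand_erase (hP : P ∈ 𝒜) (i : ℕ) :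
    partDemand (𝒜.erase P) i + partWeight i #P = partDemand 𝒜 i :=
  sum_erase_add _ _ hP

theorem partDemand_insert_le (Y : Finset V) (i : ℕ) :
    partDemand (insert Y 𝒜) i ≤ partDemand 𝒜 i + partWeight i #Y := by
  by_cases h : Y ∈ 𝒜
  · rw [insert_eq_of_mem h]; omega
  · unfold partDemand
    rw [sum_insert h, add_comm]

theorem union_biUnion_erase {G : SimpleGraph V} {g : V → ℤ} (hG : Good G g 𝒜 S lv tm)
    (hP : P ∈ 𝒜) (U : Finset V) :
    S ∪ ((P \ U) ∪ (𝒜.erase P).biUnion id) = (S ∪ 𝒜.biUnion id) \ (P ∩ U) := by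
  ext x
  simp only [mem_union, mem_sdiff, mem_biUnion, mem_erase, id, mem_inter]
  constructor
  · rintro (h | ⟨h1, h2⟩ | ⟨Q, ⟨hQ, hQ'⟩, hx⟩)
    · exact ⟨Or.inl h, fun h' => disjoint_left.1 (hG.disjQueue P hP) h'.1 h⟩
    · exact ⟨Or.inr ⟨P, hP, h1⟩, fun h' => h2 h'.2⟩
    · exact ⟨Or.inr ⟨Q, hQ', hx⟩, fun h' => disjoint_left.1 (hG.disj Q hQ' P hP hQ) hx h'.1⟩
  · rintro ⟨h | ⟨Q, hQ, hx⟩, h'⟩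
    · exact Or.inl h
    · by_cases hQP : Q = P
      · subst hQP
        exact Or.inr (Or.inl ⟨hx, fun hU => h' ⟨hx, hU⟩⟩)
      · exact Or.inr (Or.inr ⟨Q, ⟨hQP, hQ⟩, hx⟩)

end Erase

/-- The function which is constantly `j` on `Y` and equal to `l` elsewhere. -/
def setOn (Y : Finset V) (j : ℕ) (l : V → ℕ) (v : V) : ℕ := if v ∈ Y then j else l v

theorem setOn_of_mem {Y : Finset V} {v : V} (h : v ∈ Y) (j : ℕ) (l : V → ℕ) :
    setOn Y j l v = j := if_pos h

theorem setOn_of_notMem {Y : Finset V} {v : V} (h : v ∉ Y) (j : ℕ) (l : V → ℕ) :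
    setOn Y j l v = l v := if_neg h

theorem layer_enqueue_le (𝒜 : Finset (Finset V)) {S Y : Finset V} (hd : Disjoint Y S) (j : ℕ)
    (lv : V → ℕ) (i : ℕ) :
    layer 𝒜 (S ∪ Y) (setOn Y j lv) i ≤
      layer 𝒜 S lv i + if 1 ≤ i ∧ i ≤ j then #Y else 0 := by
  unfold layer
  rw [filter_union]
  have h1 : ({w ∈ S | 1 ≤ i ∧ i ≤ setOn Y j lv w} : Finset V) = {w ∈ S | 1 ≤ i ∧ i ≤ lv w} :=
    filter_congr fun w hw => by rw [setOn_of_notMem (disjoint_right.1 hd hw)]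
  have h2 : #{w ∈ Y | 1 ≤ i ∧ i ≤ setOn Y j lv w} ≤ if 1 ≤ i ∧ i ≤ j then #Y else 0 := by
    split_ifs with h
    · exact card_filter_le _ _
    · rw [Nat.le_zero, card_eq_zero, filter_eq_empty_iff]
      intro w hw
      rwa [setOn_of_mem hw]
  have := card_union_le ({w ∈ S | 1 ≤ i ∧ i ≤ lv w} : Finset V)
    {w ∈ Y | 1 ≤ i ∧ i ≤ setOn Y j lv w}
  rw [h1]
  omega

/-- The later time stamp puts newcomers behind old vertices of equal level, so only vertices of
lower level are pushed back. -/
theorem queueRank_enqueue_le_of_mem {S Y : Finset V} (hd : Disjoint Y S) {j T : ℕ}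
    {lv tm : V → ℕ} (hT : ∀ v ∈ S, tm v < T) {w : V} (hw : w ∈ S) :
    queueRank (S ∪ Y) (setOn Y j lv) (setOn Y T tm) w ≤
      queueRank S lv tm w + if lv w < j then #Y else 0 := by
  unfold queueRank
  have hwY := disjoint_right.1 hd hw
  rw [filter_union, setOn_of_notMem hwY, setOn_of_notMem hwY]
  refine (card_union_le _ _).trans (add_le_add (card_le_card fun x hx => ?_) ?_)
  · simp only [mem_filter] at hx ⊢
    rwa [setOn_of_notMem (disjoint_right.1 hd hx.1), setOn_of_notMem (disjoint_right.1 hd hx.1)]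
      at hx
  · split_ifs with h
    · exact card_filter_le _ _
    · rw [Nat.le_zero, card_eq_zero, filter_eq_empty_iff]
      intro x hx
      rw [setOn_of_mem hx, setOn_of_mem hx]
      have := hT w hw
      omega

theorem queueRank_enqueue_le {S Y : Finset V} (hd : Disjoint Y S) {j T : ℕ}
    {lv tm : V → ℕ} {w : V} (hw : w ∈ Y) :
    queueRank (S ∪ Y) (setOn Y j lv) (setOn Y T tm) w ≤ #{v ∈ S | j ≤ lv v} + #Y := by
  unfold queueRank
  rw [filter_union, setOn_of_mem hw, setOn_of_mem hw]
  refine (card_union_le _ _).trans (add_le_add (card_le_card fun x hx => ?_) (card_filter_le _ _))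
  simp only [mem_filter] at hx ⊢
  rw [setOn_of_notMem (disjoint_right.1 hd hx.1)] at hx
  exact ⟨hx.1, by omega⟩

/-! ### Bob's four moves -/

section Moves

variable {G : SimpleGraph V} {g : V → ℤ} {𝒜 : Finset (Finset V)} {S U : Finset V}
  {lv tm : V → ℕ}

/-- Bob colors the marked vertices of the part `P` and moves its other vertices to the queue. -/
theorem Good.enqueue (hG : Good G g 𝒜 S lv tm) {P : Finset V} (hP : P ∈ 𝒜) {j : ℕ} (hj : 1 ≤ j)
    (hparts : ∀ Q ∈ 𝒜, Q ≠ P → ∀ X ⊆ Q,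
      (demand (𝒜.erase P) (S ∪ P \ U) (setOn (P \ U) j lv) #X : ℤ) ≤ ∑ v ∈ X, spend U g v)
    (hold : ∀ v ∈ S, (if lv v < j then #(P \ U) else 0) + (if v ∈ U then 1 else 0) ≤
      partWeight (lv v) #P)
    (hnew : ∀ v ∈ P \ U, (partDemand (𝒜.erase P) j : ℤ) + #{v ∈ S | j ≤ lv v} + #(P \ U) ≤ g v) :
    Good G (spend U g) (𝒜.erase P) (S ∪ P \ U) (setOn (P \ U) j lv)
      (setOn (P \ U) (S.sup tm + 1) tm) := by
  have hd : Disjoint (P \ U) S := (hG.disjQueue P hP).mono_left sdiff_subset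
  refine ⟨?_, ?_, ?_, ?_, ?_, ?_, ?_⟩
  · exact fun A hA B hB => hG.disj A (mem_of_mem_erase hA) B (mem_of_mem_erase hB)
  · intro A hA
    rw [disjoint_union_right]
    exact ⟨hG.disjQueue A (mem_of_mem_erase hA),
      (hG.disj A (mem_of_mem_erase hA) P hP (ne_of_mem_erase hA)).mono_right sdiff_subset⟩
  · exact fun A hA => hG.indep A (mem_of_mem_erase hA)
  · exact fun A hA => hG.two_le A (mem_of_mem_erase hA)
  · intro v hv
    by_cases hvY : v ∈ P \ U
    · rwa [setOn_of_mem hvY]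
    · rw [setOn_of_notMem hvY]
      exact hG.one_le v ((mem_union.1 hv).resolve_right hvY)
  · exact fun A hA => hparts A (mem_of_mem_erase hA) (ne_of_mem_erase hA)
  · intro v hv
    by_cases hvY : v ∈ P \ U
    · have h1 := queueRank_enqueue_le hd (j := j) (T := S.sup tm + 1) (lv := lv) (tm := tm) hvY
      have h2 := hnew v hvY
      rw [setOn_of_mem hvY, spend, if_neg (mem_sdiff.1 hvY).2]
      omega
    · have hvS := (mem_union.1 hv).resolve_right hvY
      have h1 := queueRank_enqueue_le_of_mem hd (j := j) (T := S.sup tm + 1) (lv := lv) (tm := tm)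
        (fun v hv => Nat.lt_succ_of_le (le_sup hv)) hvS
      have h2 := hold v hvS
      have h3 := hG.queue v hvS
      have h4 := partDemand_erase hP (lv v)
      rw [setOn_of_notMem hvY, spend]
      split_ifs at * <;> omega

/-- Bob colors a part all of whose vertices are marked. -/
theorem Good.color_part (hG : Good G g 𝒜 S lv tm) {P : Finset V} (hP : P ∈ 𝒜) (hPU : P ⊆ U) :
    ∃ 𝒬 T lv' tm', Good G (spend U g) 𝒬 T lv' tm' ∧
      T ∪ 𝒬.biUnion id = (S ∪ 𝒜.biUnion id) \ (P ∩ U) := by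
  have hY : P \ U = ∅ := sdiff_eq_empty_iff_subset.2 hPU
  -- Nothing is enqueued, so the level 1 is immaterial.
  refine ⟨_, _, _, _, hG.enqueue hP le_rfl ?_ ?_ ?_, ?_⟩
  · intro Q hQ _ X hX
    have h1 := hG.parts Q hQ X hX
    have h2 := sum_range_add_le (a := layer 𝒜 S lv)
      (b := layer (𝒜.erase P) (S ∪ P \ U) (setOn (P \ U) 1 lv)) #X fun i _ => by
        have h1 := layer_enqueue_le (𝒜.erase P)
          ((hG.disjQueue P hP).mono_left (sdiff_subset (t := U))) 1 lv i
        have h2 := partDemand_erase hP i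
        have h3 := one_le_partWeight i #P
        have h4 : layer (𝒜.erase P) S lv i + partWeight i #P = layer 𝒜 S lv i := by
          unfold layer; omega
        rw [hY, card_empty, ite_self] at h1
        rw [hY]
        omega
    have h3 : #(X ∩ U) ≤ #X := card_le_card inter_subset_left
    rw [sum_spend]
    unfold demand at *
    omega
  · intro v _
    have := one_le_partWeight (lv v) #P
    rw [hY, card_empty, ite_self]
    split_ifs <;> omega
  · simp [hY]
  · rw [union_assoc, union_biUnion_erase hG hP]

/-- Bob colors the marked vertices of a part in which a marked subset `X` is tight, where no larger
marked subset of a part is. -/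
theorem Good.color_tight (hG : Good G g 𝒜 S lv tm) {P X : Finset V} (hP : P ∈ 𝒜)
    (hX : X ⊆ P ∩ U) (hne : X.Nonempty) (hPU : ¬ P ⊆ U) (ht : ∑ v ∈ X, g v ≤ demand 𝒜 S lv #X)
    (hmax : ∀ Q ∈ 𝒜, ∀ Z ⊆ Q ∩ U, #X < #Z → (demand 𝒜 S lv #Z : ℤ) < ∑ v ∈ Z, g v) :
    ∃ 𝒬 T lv' tm', Good G (spend U g) 𝒬 T lv' tm' ∧
      T ∪ 𝒬.biUnion id = (S ∪ 𝒜.biUnion id) \ (P ∩ U) := by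
  have hd : Disjoint (P \ U) S := (hG.disjQueue P hP).mono_left sdiff_subset
  have hj : 1 ≤ #X := hne.card_pos
  have hY : #(P \ U) + #X ≤ #P := by
    have := card_le_card hX
    have := card_sdiff_add_card_inter P U
    omega
  have hY1 : 1 ≤ #(P \ U) := card_pos.2 (sdiff_nonempty.2 hPU)
  -- For 1 ≤ i ≤ #X the layer loses #P - i and gains at most #(P \ U) ≤ #P - #X, so only layer #X
  -- can break even. All other layers only lose.
  have hl : ∀ i, layer (𝒜.erase P) (S ∪ P \ U) (setOn (P \ U) #X lv) i +
      (if i = #X then 0 else 1) ≤ layer 𝒜 S lv i := by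
    intro i
    have h1 := layer_enqueue_le (𝒜.erase P) hd #X lv i
    have h2 := partDemand_erase hP i
    have h4 : layer (𝒜.erase P) S lv i + partWeight i #P = layer 𝒜 S lv i := by
      unfold layer; omega
    unfold partWeight at h4
    split_ifs at * <;> omega
  refine ⟨_, _, _, _, hG.enqueue hP hj ?_ ?_ ?_, ?_⟩
  · intro Q hQ _ Z hZ
    have h1 := hG.parts Q hQ Z hZ
    have h3 : #(Z ∩ U) ≤ #Z := card_le_card inter_subset_left
    by_cases hZX : #Z ≤ #X
    · have h2 := sum_range_add_le (a := layer 𝒜 S lv)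
        (b := layer (𝒜.erase P) (S ∪ P \ U) (setOn (P \ U) #X lv)) #Z fun i hi => by
          have := hl i
          rwa [if_neg (by omega)] at this
      rw [sum_spend]
      unfold demand at *
      omega
    · have h2 := sum_range_add_pred_le (a := layer 𝒜 S lv)
        (b := layer (𝒜.erase P) (S ∪ P \ U) (setOn (P \ U) #X lv)) (j := #X)
        (fun i hi => by have := hl i; rwa [if_neg hi] at this)
        (by have := hl #X; omega) #Z
      refine le_sum_spend_of_not_tight h3 h1
        (fun h _ => hmax Q hQ Z (subset_inter hZ h) (by omega)) ?_
      unfold demand at *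
      omega
  · intro v hv
    have := hG.one_le v hv
    unfold partWeight
    split_ifs <;> omega
  · intro v hv
    obtain ⟨hvP, hvU⟩ := mem_sdiff.1 hv
    have hvX : v ∉ X := fun h => hvU (mem_inter.1 (hX h)).2
    -- Since `X` is tight, `v` alone must own layer #X. There `P` weighs #P - #X, which pays for the
    -- ranks of the #(P \ U) newcomers.
    have h1 := hG.parts P hP (insert v X)
      (insert_subset hvP (hX.trans inter_subset_left))
    rw [sum_insert hvX, card_insert_of_notMem hvX, demand, sum_range_succ] at h1
    unfold demand at ht
    have h2 := partDemand_erase hP #X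
    have h3 : layer 𝒜 S lv #X = partDemand 𝒜 #X + #{w ∈ S | #X ≤ lv w} := by
      simp only [layer, hj, true_and]
    unfold partWeight at h2
    rw [if_neg (by omega)] at h2
    omega
  · rw [union_assoc, union_biUnion_erase hG hP]

/-- Bob colors the first marked vertex of the queue. -/
theorem Good.color_queue (hG : Good G g 𝒜 S lv tm) {v : V} (hv : v ∈ S)
    (hmin : ∀ w ∈ S ∩ U, lv w < lv v ∨ (lv w = lv v ∧ tm v ≤ tm w))
    (ht : ∀ P ∈ 𝒜, ∀ X ⊆ P ∩ U, X.Nonempty → (demand 𝒜 S lv #X : ℤ) < ∑ v ∈ X, g v)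
    (hle : ∀ P ∈ 𝒜, #(P ∩ U) ≤ lv v) :
    Good G (spend U g) 𝒜 (S.erase v) lv tm ∧
      S.erase v ∪ 𝒜.biUnion id = (S ∪ 𝒜.biUnion id) \ {v} := by
  refine ⟨⟨hG.disj, fun P hP => (hG.disjQueue P hP).mono_right (erase_subset _ _), hG.indep,
    hG.two_le, fun w hw => hG.one_le w (mem_of_mem_erase hw), ?_, ?_⟩, ?_⟩
  · intro P hP X hX
    -- Removing `v` lowers exactly the layers 1, …, `lv v`, and no part has more than `lv v` marked
    -- vertices.
    refine le_sum_spend_of_not_tight ((card_le_card (inter_subset_inter_right hX)).trans (hle P hP))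
      (hG.parts P hP X hX) (fun h hne => ht P hP X (subset_inter hX h) hne)
      (sum_range_add_min_le (fun i => ?_) (fun i h1 h2 => ?_) _)
    · exact add_le_add le_rfl (card_le_card (filter_subset_filter _ (erase_subset _ _)))
    · unfold layer
      rw [filter_erase, card_erase_of_mem (by simp [hv, h1, h2])]
      have : 0 < #{w ∈ S | 1 ≤ i ∧ i ≤ lv w} := card_pos.2 ⟨v, by simp [hv, h1, h2]⟩
      omega
  · intro w hw
    have h1 := hG.queue w (mem_of_mem_erase hw)
    have h2 : queueRank (S.erase v) lv tm w + (if w ∈ U then 1 else 0) ≤ queueRank S lv tm w := by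
      unfold queueRank
      rw [filter_erase]
      split_ifs with hwU
      · have := hmin w (mem_inter.2 ⟨mem_of_mem_erase hw, hwU⟩)
        have hm : v ∈ ({x ∈ S | lv w < lv x ∨ (lv w = lv x ∧ tm x ≤ tm w)} : Finset V) := by
          simp [hv, this]
        rw [card_erase_of_mem hm]
        have := card_pos.2 ⟨v, hm⟩
        omega
      · exact card_le_card (erase_subset _ _)
    unfold spend
    split_ifs at * <;> omega
  · ext x
    simp only [mem_union, mem_erase, mem_sdiff, mem_singleton, mem_biUnion, id]
    constructor
    · rintro (⟨h1, h2⟩ | ⟨P, hP, hx⟩)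
      · exact ⟨Or.inl h2, h1⟩
      · refine ⟨Or.inr ⟨P, hP, hx⟩, ?_⟩
        rintro rfl
        exact disjoint_left.1 (hG.disjQueue P hP) hx hv
    · rintro ⟨h | h, h'⟩
      · exact Or.inl ⟨h', h⟩
      · exact Or.inr h

/-- Bob colors the marked vertices of a part that has the most marked vertices. -/
theorem Good.color_max [Fintype V] (hG : Good G g 𝒜 S lv tm) {P : Finset V} (hP : P ∈ 𝒜)
    (hPU : ¬ P ⊆ U) (hmax : ∀ Q ∈ 𝒜, #(Q ∩ U) ≤ #(P ∩ U))
    (ht : ∀ P ∈ 𝒜, ∀ X ⊆ P ∩ U, X.Nonempty → (demand 𝒜 S lv #X : ℤ) < ∑ v ∈ X, g v)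
    (hS : ∀ w ∈ S ∩ U, lv w < #(P ∩ U)) :
    ∃ 𝒬 T lv' tm', Good G (spend U g) 𝒬 T lv' tm' ∧
      T ∪ 𝒬.biUnion id = (S ∪ 𝒜.biUnion id) \ (P ∩ U) := by
  have hYP : P \ U ⊆ P := sdiff_subset
  have hd : Disjoint (P \ U) S := (hG.disjQueue P hP).mono_left hYP
  have hY : #(P \ U) + #(P ∩ U) = #P := card_sdiff_add_card_inter P U
  have hY1 : 1 ≤ #(P \ U) := card_pos.2 (sdiff_nonempty.2 hPU)
  have key : ∀ b : ℕ → ℕ, (∀ n, b n + min (n - 1) #(P ∩ U) ≤ demand 𝒜 S lv n) →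
      ∀ Q ∈ 𝒜, ∀ X ⊆ Q, (b #X : ℤ) ≤ ∑ v ∈ X, spend U g v := fun b hb Q hQ X hX =>
    le_sum_spend_of_not_tight ((card_le_card (inter_subset_inter_right hX)).trans (hmax Q hQ))
      (hG.parts Q hQ X hX) (fun h hne => ht Q hQ X (subset_inter hX h) hne) (hb _)
  by_cases hY2 : 2 ≤ #(P \ U)
  · have hdem : ∀ i, partDemand (insert (P \ U) (𝒜.erase P)) i +
        (if 1 ≤ i ∧ i ≤ #(P ∩ U) then 1 else 0) ≤ partDemand 𝒜 i := by
      intro i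
      have h1 := partDemand_insert_le (𝒜 := 𝒜.erase P) (P \ U) i
      have h2 := partDemand_erase hP i
      -- For 1 ≤ i ≤ #(P ∩ U) the old weight is at least #(P \ U), and the new one is smaller since
      -- #(P \ U) ≥ 2.
      have h3 : partWeight i #(P \ U) + (if 1 ≤ i ∧ i ≤ #(P ∩ U) then 1 else 0) ≤
          partWeight i #P := by
        unfold partWeight
        split_ifs <;> omega
      omega
    have hb : ∀ n, demand (insert (P \ U) (𝒜.erase P)) S lv n + min (n - 1) #(P ∩ U) ≤
        demand 𝒜 S lv n := by
      refine sum_range_add_min_le (fun i => ?_) (fun i h1 h2 => ?_)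
      · have := hdem i
        unfold layer
        omega
      · have := hdem i
        rw [if_pos ⟨h1, h2⟩] at this
        unfold layer
        omega
    refine ⟨insert (P \ U) (𝒜.erase P), S, lv, tm, ⟨?_, ?_, ?_, ?_, hG.one_le, ?_, ?_⟩, ?_⟩
    · intro A hA B hB hAB
      rcases mem_insert.1 hA with rfl | hA' <;> rcases mem_insert.1 hB with rfl | hB'
      · exact (hAB rfl).elim
      · exact (hG.disj P hP B (mem_of_mem_erase hB') (ne_of_mem_erase hB').symm).mono_left hYP
      · exact (hG.disj A (mem_of_mem_erase hA') P hP (ne_of_mem_erase hA')).mono_right hYP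
      · exact hG.disj A (mem_of_mem_erase hA') B (mem_of_mem_erase hB') hAB
    · intro A hA
      rcases mem_insert.1 hA with rfl | hA'
      · exact hd
      · exact hG.disjQueue A (mem_of_mem_erase hA')
    · intro A hA
      rcases mem_insert.1 hA with rfl | hA'
      · exact (hG.indep P hP).mono (coe_subset.2 hYP)
      · exact hG.indep A (mem_of_mem_erase hA')
    · intro A hA
      rcases mem_insert.1 hA with rfl | hA'
      · exact hY2
      · exact hG.two_le A (mem_of_mem_erase hA')
    · intro A hA X hX
      rcases mem_insert.1 hA with rfl | hA'
      · exact key _ hb P hP X (hX.trans hYP)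
      · exact key _ hb A (mem_of_mem_erase hA') X hX
    · intro w hw
      have h1 := hdem (lv w)
      have h2 := hG.queue w hw
      have h3 := hG.one_le w hw
      unfold spend
      split_ifs with hwU
      · have := hS w (mem_inter.2 ⟨hw, hwU⟩)
        rw [if_pos ⟨h3, this.le⟩] at h1
        omega
      · omega
    · rw [biUnion_insert, id, union_biUnion_erase hG hP]
  · replace hY2 : #(P \ U) = 1 := by omega
    have hcard : #P ≤ Fintype.card V := card_le_univ P
    have hp := hG.two_le P hP
    -- Above all levels and part sizes: the lone leftover vertex heads the queue, and every
    -- remaining part weighs 1 at its level.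
    set M := S.sup lv + Fintype.card V + 1 with hM
    have hlv : ∀ w ∈ S, lv w < M := fun w hw => by have := le_sup (f := lv) hw; omega
    have hb : ∀ n, demand (𝒜.erase P) (S ∪ P \ U) (setOn (P \ U) M lv) n +
        min (n - 1) #(P ∩ U) ≤ demand 𝒜 S lv n := by
      -- Here #P = #(P ∩ U) + 1. Layer 0 loses the part, and a layer i with 1 ≤ i < #(P ∩ U) trades
      -- weight at least 2 for 1.
      have hl : ∀ i, layer (𝒜.erase P) (S ∪ P \ U) (setOn (P \ U) M lv) i +
          (if i < #(P ∩ U) then 1 else 0) ≤ layer 𝒜 S lv i := by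
        intro i
        have h1 := layer_enqueue_le (𝒜.erase P) hd M lv i
        have h2 := partDemand_erase hP i
        have h4 : layer (𝒜.erase P) S lv i + partWeight i #P = layer 𝒜 S lv i := by
          unfold layer; omega
        unfold partWeight at h4
        split_ifs at * <;> omega
      have : ∀ n, demand (𝒜.erase P) (S ∪ P \ U) (setOn (P \ U) M lv) n +
          min n #(P ∩ U) ≤ demand 𝒜 S lv n := by
        intro n
        unfold demand
        induction n with
        | zero => simp
        | succ n ih =>
          have := hl n
          rw [sum_range_succ, sum_range_succ]
          split_ifs at this <;> omega
      intro n
      have := this n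
      omega
    refine ⟨_, _, _, _, hG.enqueue hP (by omega : 1 ≤ M) (fun Q hQ _ => key _ hb Q hQ) ?_ ?_, ?_⟩
    · intro w hw
      have := hG.one_le w hw
      have h2 := hlv w hw
      unfold partWeight
      by_cases hwU : w ∈ U
      · have := hS w (mem_inter.2 ⟨hw, hwU⟩)
        split_ifs <;> omega
      · split_ifs <;> omega
    · intro w hw
      have h1 := hG.parts P hP {w} (by simpa using hYP hw)
      have h2 : ({x ∈ S | M ≤ lv x} : Finset V) = ∅ :=
        filter_eq_empty_iff.2 fun x hx => by have := hlv x hx; omega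
      have h3 : partDemand (𝒜.erase P) M = partDemand (𝒜.erase P) 0 :=
        sum_congr rfl fun Q _ => by
          have : #Q ≤ Fintype.card V := card_le_univ Q
          unfold partWeight
          split_ifs <;> omega
      have h4 := partDemand_erase hP 0
      have h5 := one_le_partWeight 0 #P
      rw [h2, h3, hY2]
      simp [demand, layer] at h1 ⊢
      omega
    · rw [union_assoc, union_biUnion_erase hG hP]

end Moves

/-! ### The winning strategy -/

theorem Good.pos {G : SimpleGraph V} {g : V → ℤ} {𝒜 : Finset (Finset V)} {S : Finset V}
    {lv tm : V → ℕ} (hG : Good G g 𝒜 S lv tm) {v : V} (hv : v ∈ S ∪ 𝒜.biUnion id) : 0 < g v := by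
  rcases mem_union.1 hv with h | h
  · have h1 := hG.queue v h
    have h2 : 0 < queueRank S lv tm v := card_pos.2 ⟨v, by simp [h]⟩
    omega
  · obtain ⟨P, hP, hvP⟩ := mem_biUnion.1 h
    have h1 := hG.parts P hP {v} (by simpa using hvP)
    have h2 := partDemand_erase hP 0
    have h3 := one_le_partWeight 0 #P
    simp [demand, layer] at h1
    omega

theorem Good.exists_move [Fintype V] {G : SimpleGraph V} {g : V → ℤ} {𝒜 : Finset (Finset V)}
    {S : Finset V} {lv tm : V → ℕ} (hG : Good G g 𝒜 S lv tm) {U : Finset V}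
    (hU : U ⊆ S ∪ 𝒜.biUnion id) (hne : U.Nonempty) :
    ∃ X ⊆ U, G.IsIndepSet (X : Set V) ∧ ∃ ℬ T lv' tm', Good G (spend U g) ℬ T lv' tm' ∧
      T ∪ ℬ.biUnion id = (S ∪ 𝒜.biUnion id) \ X := by
  have hind : ∀ P ∈ 𝒜, G.IsIndepSet ((P ∩ U : Finset V) : Set V) := fun P hP =>
    (hG.indep P hP).mono (coe_subset.2 inter_subset_left)
  by_cases hfull : ∃ P ∈ 𝒜, P ⊆ U
  · obtain ⟨P, hP, hPU⟩ := hfull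
    exact ⟨P ∩ U, inter_subset_right, hind P hP, hG.color_part hP hPU⟩
  push Not at hfull
  let tight : Finset (Finset V) :=
    {X | X.Nonempty ∧ ∑ v ∈ X, g v ≤ demand 𝒜 S lv #X ∧ ∃ P ∈ 𝒜, X ⊆ P ∩ U}
  by_cases htight : tight.Nonempty
  · obtain ⟨X, hX, hmax⟩ := exists_max_image tight card htight
    obtain ⟨hXne, hXt, P, hP, hXP⟩ := (mem_filter.1 hX).2
    refine ⟨P ∩ U, inter_subset_right, hind P hP,
      hG.color_tight hP hXP hXne (hfull P hP) hXt fun Q hQ Z hZ hlt => ?_⟩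
    by_contra! hcon
    have := hmax Z (mem_filter.2 ⟨mem_univ _, card_pos.1 (by omega), hcon, Q, hQ, hZ⟩)
    omega
  have ht : ∀ P ∈ 𝒜, ∀ X ⊆ P ∩ U, X.Nonempty → (demand 𝒜 S lv #X : ℤ) < ∑ v ∈ X, g v := by
    intro P hP X hX hXne
    by_contra! hcon
    exact htight ⟨X, mem_filter.2 ⟨mem_univ _, hXne, hcon, P, hP, hX⟩⟩
  -- A queued vertex is served if its level reaches every marked count; otherwise every marked
  -- queued vertex lies below the largest count.
  by_cases hq : ∃ v ∈ S ∩ U, ∀ P ∈ 𝒜, #(P ∩ U) ≤ lv v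
  · obtain ⟨v, hv, hle⟩ := hq
    obtain ⟨w, hw, hwmax⟩ := exists_max_image (S ∩ U) lv ⟨v, hv⟩
    obtain ⟨x, hx, hxmin⟩ := exists_min_image {y ∈ S ∩ U | lv y = lv w} tm ⟨w, by simp [hw]⟩
    obtain ⟨hxSU, hxw⟩ := mem_filter.1 hx
    obtain ⟨hxS, hxU⟩ := mem_inter.1 hxSU
    refine ⟨{x}, by simpa using hxU, by simp [SimpleGraph.IsIndepSet], _, _, _, _,
      hG.color_queue hxS (fun y hy => ?_) ht fun P hP => ?_⟩
    · rw [hxw]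
      rcases (hwmax y hy).lt_or_eq with h | h
      · exact Or.inl h
      · exact Or.inr ⟨h, hxmin y (mem_filter.2 ⟨hy, h⟩)⟩
    · have := hle P hP
      have := hwmax v hv
      omega
  push Not at hq
  have hA : 𝒜.Nonempty := by
    obtain ⟨v, hv⟩ := hne
    rcases mem_union.1 (hU hv) with h | h
    · obtain ⟨P, hP, -⟩ := hq v (mem_inter.2 ⟨h, hv⟩)
      exact ⟨P, hP⟩
    · obtain ⟨P, hP, -⟩ := mem_biUnion.1 h
      exact ⟨P, hP⟩
  obtain ⟨P, hP, hmax⟩ := exists_max_image 𝒜 (fun P => #(P ∩ U)) hA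
  refine ⟨P ∩ U, inter_subset_right, hind P hP,
    hG.color_max hP (hfull P hP) hmax ht fun w hw => ?_⟩
  obtain ⟨Q, hQ, hlt⟩ := hq w hw
  exact hlt.trans_le (hmax Q hQ)

theorem Good.onlineChoosable [Fintype V] {G : SimpleGraph V} {f : V → ℕ} {𝒜 : Finset (Finset V)}
    {S : Finset V} {lv tm : V → ℕ} (hG : Good G (fun v => f v) 𝒜 S lv tm)
    (hcover : S ∪ 𝒜.biUnion id = univ) : OnlineChoosable G f := by
  refine onlineChoosable_of_invariant G f
    (fun C g => ∃ 𝒜 S lv tm, Good G g 𝒜 S lv tm ∧ S ∪ 𝒜.biUnion id = C)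
    ⟨𝒜, S, lv, tm, hG, hcover⟩ ?_ ?_
  · rintro _ g ⟨𝒜, S, lv, tm, hG, rfl⟩ v hv
    exact hG.pos hv
  · rintro _ g ⟨𝒜, S, lv, tm, hG, rfl⟩ U hU hne
    exact hG.exists_move hU hne

/-! ### The initial position and the numerical condition -/

/-- In layer i ≥ 1 the excess over 1 is p - 1 - i while positive, and these excesses add up to
C(p-1, 2). -/
theorem sum_range_partWeight_le (p j : ℕ) :
    ∑ i ∈ range (j + 1), partWeight i p ≤ j + 1 + (p - 1).choose 2 := by
  have h : ∀ j, j + 1 ≤ p →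
      ∑ i ∈ range (j + 1), partWeight i p + (p - 1 - j).choose 2 = j + 1 + (p - 1).choose 2 := by
    intro j
    induction j with
    | zero => intro _; simp [partWeight]
    | succ j ih =>
      intro hj
      rw [sum_range_succ]
      have h1 := ih (by omega)
      obtain ⟨q, rfl⟩ : ∃ q, p = j + 2 + q := ⟨p - (j + 2), by omega⟩
      have e1 : j + 2 + q - 1 - j = q + 1 := by omega
      have e2 : j + 2 + q - 1 - (j + 1) = q := by omega
      rw [e1, Nat.choose_succ_succ' q 1, Nat.choose_one_right, show 1 + 1 = 2 from rfl] at h1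
      rw [e2]
      have : partWeight (j + 1) (j + 2 + q) = q + 1 := by unfold partWeight; simp; omega
      omega
  induction j with
  | zero => simp [partWeight]
  | succ j ih =>
    by_cases hj : j + 2 ≤ p
    · have := h (j + 1) hj
      omega
    · rw [sum_range_succ]
      have : partWeight (j + 1) p = 1 := by unfold partWeight; simp; omega
      omega

/-- The part sizes of a coloring with `k` colors suffice for on-line `k`-choosability. -/
theorem onlineChoosable_of_coloring [Fintype V] {G : SimpleGraph V} {k : ℕ}
    (c : G.Coloring (Fin k)) (hc : Function.Surjective c)
    (h : ∑ a, (#{v | c v = a} - 1).choose 2 ≤ #{a : Fin k | #{v | c v = a} = 1}) :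
    OnlineChoosable G (fun _ => k) := by
  classical
  let cls : Fin k → Finset V := fun a => {v | c v = a}
  have hcls : ∀ a v, v ∈ cls a ↔ c v = a := fun a v => by simp [cls]
  have hpos : ∀ a, 1 ≤ #(cls a) := fun a => by
    obtain ⟨v, hv⟩ := hc a
    exact card_pos.2 ⟨v, (hcls a v).2 hv⟩
  have hinj : Function.Injective cls := by
    intro a b hab
    obtain ⟨v, hv⟩ := hc a
    have : v ∈ cls b := hab ▸ (hcls a v).2 hv
    exact hv.symm.trans ((hcls b v).1 this)
  let big : Finset (Fin k) := {a | 2 ≤ #(cls a)}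
  let one : Finset (Fin k) := {a | #(cls a) = 1}
  let 𝒜 : Finset (Finset V) := big.image cls
  let S : Finset V := {v | #(cls (c v)) = 1}
  have hbo : #big + #one = k := by
    rw [← card_union_of_disjoint]
    · convert card_fin k
      ext a
      have := hpos a
      simp only [big, one, mem_union, mem_filter, mem_univ, true_and, iff_true]
      omega
    · rw [disjoint_left]
      intro a ha hb
      simp only [big, one, mem_filter, mem_univ, true_and] at ha hb
      omega
  have hS : #S ≤ #one := by
    refine card_le_card_of_injOn c (fun v hv => ?_) ?_
    · simpa [S, one] using hv
    · intro v hv w hw hvw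
      have h1 : #(cls (c v)) = 1 := by simpa [S] using hv
      exact card_le_one.1 h1.le v ((hcls _ _).2 rfl) w ((hcls _ _).2 hvw.symm)
  have hdem : ∀ i, partDemand 𝒜 i = ∑ a ∈ big, partWeight i #(cls a) := fun i =>
    sum_image fun a _ b _ hab => hinj hab
  have hA : ∀ P ∈ 𝒜, ∃ a, 2 ≤ #(cls a) ∧ cls a = P := fun P hP => by simpa [𝒜, big] using hP
  -- At a level above all part sizes every part weighs 1, so a singleton needs at most one token per
  -- color class.
  refine Good.onlineChoosable (𝒜 := 𝒜) (S := S) (lv := fun _ => Fintype.card V + 1)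
    (tm := fun _ => 0) ⟨?_, ?_, ?_, ?_, ?_, ?_, ?_⟩ ?_
  · intro P hP Q hQ hPQ
    obtain ⟨a, -, rfl⟩ := hA P hP
    obtain ⟨b, -, rfl⟩ := hA Q hQ
    rw [disjoint_left]
    intro v hv hw
    rw [hcls] at hv hw
    exact hPQ (by rw [← hv, ← hw])
  · intro P hP
    obtain ⟨a, ha, rfl⟩ := hA P hP
    rw [disjoint_left]
    intro v hv hvS
    rw [hcls] at hv
    have : #(cls (c v)) = 1 := by simpa [S] using hvS
    rw [hv] at this
    omega
  · intro P hP v hv w hw _ hvw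
    obtain ⟨a, ha, rfl⟩ := hA P hP
    rw [mem_coe, hcls] at hv hw
    exact c.valid hvw (hv.trans hw.symm)
  · intro P hP
    obtain ⟨a, ha, rfl⟩ := hA P hP
    exact ha
  · intro v _
    omega
  · intro P _ X _
    simp only [sum_const, nsmul_eq_mul]
    -- For j ≥ 1 the singletons count in only j - 1 layers, and the missing `#one` absorbs the
    -- excess of the parts.
    have : ∀ j, demand 𝒜 S (fun _ => Fintype.card V + 1) j ≤ j * k := by
      intro j
      cases j with
      | zero => simp [demand]
      | succ j =>
        have h1 : ∀ n, ∑ i ∈ range (n + 1),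
            #{w ∈ S | 1 ≤ i ∧ i ≤ (fun _ => Fintype.card V + 1) w} ≤ n * #one := by
          intro n
          induction n with
          | zero => simp
          | succ n ih =>
            rw [sum_range_succ]
            have := (card_filter_le S (fun w => 1 ≤ n + 1 ∧
              n + 1 ≤ (fun _ => Fintype.card V + 1) w)).trans hS
            linarith
        have h2 : ∑ i ∈ range (j + 1), partDemand 𝒜 i ≤
            (j + 1) * #big + ∑ a ∈ big, (#(cls a) - 1).choose 2 := by
          simp only [hdem]
          rw [sum_comm, mul_comm, ← smul_eq_mul, ← sum_const, ← sum_add_distrib]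
          exact sum_le_sum fun a _ => sum_range_partWeight_le _ _
        have h3 : ∑ a ∈ big, (#(cls a) - 1).choose 2 ≤ #one :=
          (sum_le_sum_of_subset (subset_univ _)).trans h
        have h4 := h1 j
        simp only [demand, layer, sum_add_distrib]
        nlinarith
    exact_mod_cast this #X
  · intro v _
    have h1 : partDemand 𝒜 (Fintype.card V + 1) = #big := by
      rw [hdem, card_eq_sum_ones]
      refine sum_congr rfl fun a _ => ?_
      have : #(cls a) ≤ Fintype.card V := card_le_univ _
      unfold partWeight
      simp
      omega
    have h2 : queueRank S (fun _ => Fintype.card V + 1) (fun _ => 0) v ≤ #S := card_filter_le _ _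
    simp only [h1]
    omega
  · ext v
    have := hpos (c v)
    simp only [mem_union, mem_biUnion, mem_univ, iff_true, id]
    by_cases hv : #(cls (c v)) = 1
    · exact Or.inl (by simpa [S] using hv)
    · exact Or.inr ⟨cls (c v), mem_image_of_mem _ (by simp [big]; omega), (hcls _ _).2 rfl⟩

/-- If every possible part size satisfies the linear bound of the convex function
`p ↦ (p - 1).choose 2`, minus one for `p = 1`, whose sum over the parts is nonpositive, then `G` is
on-line chromatic-choosable. -/
theorem onlineChromaticChoosable_of_linear_bound [Fintype V] {G : SimpleGraph V} (A B C : ℝ)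
    (hA : 0 < A)
    (hlin : ∀ p : ℕ, 1 ≤ p → p ≤ G.indepNum →
      A * (((p - 1).choose 2 : ℕ) - if p = 1 then 1 else 0) ≤ B * p - C)
    (hcard : B * Fintype.card V ≤ C * (G.chromaticNumber.toNat : ℝ)) :
    OnlineChromaticChoosable G := by
  classical
  obtain ⟨k, hk⟩ : ∃ k : ℕ, G.chromaticNumber = k :=
    ⟨_, (ENat.natCast_toNat (SimpleGraph.chromaticNumber_ne_top_iff_exists.2
      ⟨_, G.colorable_of_fintype⟩)).symm⟩
  refine le_antisymm ?_ (chromaticNumber_le_onlineChoiceNumber G)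
  obtain ⟨c⟩ : G.Colorable k := SimpleGraph.chromaticNumber_le_iff_colorable.1 hk.le
  have hc : Function.Surjective c :=
    SimpleGraph.le_chromaticNumber_iff_forall_surjective.1 hk.ge c
  rw [hk]
  refine iInf₂_le k (onlineChoosable_of_coloring c hc ?_)
  have hsum : ∑ a, (#{v | c v = a} : ℝ) = Fintype.card V := by
    rw [← Nat.cast_sum, ← card_eq_sum_card_fiberwise (fun v _ => mem_univ (c v)), card_univ]
  have hle : ∀ a, A * (((#{v | c v = a} - 1).choose 2 : ℕ) -
      if #{v | c v = a} = 1 then (1 : ℝ) else 0) ≤ B * #{v | c v = a} - C := by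
    intro a
    refine hlin _ ?_ ?_
    · obtain ⟨v, hv⟩ := hc a
      exact card_pos.2 ⟨v, by simpa using hv⟩
    · refine SimpleGraph.IsIndepSet.card_le_indepNum ?_
      intro v hv w hw _ hvw
      simp only [coe_filter, mem_univ, true_and, Set.mem_ofPred_eq] at hv hw
      exact c.valid hvw (hv.trans hw.symm)
  have := sum_le_sum fun a (_ : a ∈ univ) => hle a
  rw [← mul_sum, sum_sub_distrib, sum_sub_distrib, ← mul_sum, hsum, sum_boole] at this
  simp only [sum_const, card_univ, Fintype.card_fin, nsmul_eq_mul] at this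
  rw [hk, ENat.toNat_natCast] at hcard
  have h0 : A * (∑ a, (((#{v | c v = a} - 1).choose 2 : ℕ) : ℝ) -
      #{a | #{v | c v = a} = 1}) ≤ 0 := by linarith
  have h1 := nonpos_of_mul_nonpos_right h0 hA
  have h2 : (∑ a, (((#{v | c v = a} - 1).choose 2 : ℕ) : ℝ)) ≤ #{a | #{v | c v = a} = 1} := by
    linarith
  exact_mod_cast h2

end OnlineColoring

/-! ### The linear bounds for the corollary -/

theorem mainTheorem4 {V : Type*} [Fintype V] [DecidableEq V] (G : SimpleGraph V) :
    (∀ m : ℕ, 2 ≤ m → G.indepNum = m →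
      (Fintype.card V : ℝ) ≤
        ((m : ℝ) ^ 2 - (m : ℝ) + 2) / ((m : ℝ) ^ 2 - 3 * (m : ℝ) + 4) *
          (G.chromaticNumber.toNat : ℝ) →
      OnlineColoring.onlineChoiceNumber G = G.chromaticNumber) ∧
    ((Fintype.card V : ℕ∞) ≤ 2 * G.chromaticNumber → G.indepNum ≤ 3 →
      OnlineColoring.OnlineChromaticChoosable G) := by
  constructor
  · intro m hm hind hcard
    have hm' : (2 : ℝ) ≤ m := by exact_mod_cast hm
    have hD : (0 : ℝ) < (m : ℝ) ^ 2 - 3 * m + 4 := by nlinarith [sq_nonneg ((m : ℝ) - 3 / 2)]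
    rw [div_mul_eq_mul_div, le_div_iff₀ hD] at hcard
    -- Scaled by 2(m - 1), the line is the chord through p = 1 and p = m.
    refine onlineChromaticChoosable_of_linear_bound (2 * ((m : ℝ) - 1)) ((m : ℝ) ^ 2 - 3 * m + 4)
      ((m : ℝ) ^ 2 - m + 2) (by linarith) (fun p hp hpm => ?_) (by linarith)
    obtain ⟨q, rfl⟩ : ∃ q, p = q + 1 := ⟨p - 1, by omega⟩
    rw [hind] at hpm
    simp only [Nat.add_sub_cancel, Nat.cast_choose_two]
    rcases Nat.eq_zero_or_pos q with rfl | hq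
    · simp
      linarith
    · rw [if_neg (by omega)]
      push_cast
      obtain ⟨r, rfl⟩ : ∃ r, m = q + 1 + r := ⟨m - (q + 1), by omega⟩
      push_cast
      rcases Nat.eq_zero_or_pos r with rfl | hr
      · push_cast
        nlinarith
      · have hq' : (1 : ℝ) ≤ q := by exact_mod_cast hq
        have hr' : (1 : ℝ) ≤ r := by exact_mod_cast hr
        -- The gap below the chord is r(q(q + r) - 2).
        have h2 : (2 : ℝ) ≤ q * (q + r) := by nlinarith
        nlinarith [mul_nonneg (by linarith : (0 : ℝ) ≤ r) (sub_nonneg.2 h2)]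
  · intro hcard hind
    -- The line p - 2 is exact at p = 1, 2, 3, so independence numbers below 2 need no separate
    -- case.
    refine onlineChromaticChoosable_of_linear_bound 1 1 2 one_pos (fun p hp hp3 => ?_) ?_
    · have : p ≤ 3 := hp3.trans hind
      interval_cases p <;> norm_num [Nat.choose]
    · have hne : G.chromaticNumber ≠ ⊤ := SimpleGraph.chromaticNumber_ne_top_iff_exists.2
        ⟨_, G.colorable_of_fintype⟩
      rw [← ENat.natCast_toNat hne] at hcard
      rw [one_mul]
      exact_mod_cast hcard
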